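/- Let $\rho=\beta+i\gamma$ run over the non-trivial zeros of the Riemann zeta function $\zeta(s)$ (those with $0<\beta<1$), put $\delta=1-\beta$, and for real $x>0$ define $$W(x)=\sum_{\substack{\rho\\ |\gamma|\le x}}\frac{|\Gamma(\rho+1)|\,x^{\beta}}{|\gamma|},\qquad \omega(x)=\inf_{\substack{\rho=\beta+i\gamma\\ \gamma>0}}\bigl(\delta\log x+\log\gamma\bigr),$$ where zeros are counted with multiplicity in the sum. Then for every $\epsilon>0$ there is $x_0=x_0(\epsilon)$ such that for all real $x\ge x_0$, $$W(x)\le x\exp\bigl(-(1-\epsilon)\,\omega(x)\bigr).$$ -/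

import Mathlib

/-- The non-trivial zeros `ρ = β + iγ` of the Riemann zeta function:
the zeros in the critical strip `0 < β < 1`. -/
def nontrivialZeros : Set ℂ :=
  {ρ : ℂ | riemannZeta ρ = 0 ∧ 0 < ρ.re ∧ ρ.re < 1}

/-- There are only finitely many non-trivial zeros with `|γ| ≤ x`. -/
theorem finite_nontrivialZeros_abs_im_le (x : ℝ) :
    {ρ : ℂ | ρ ∈ nontrivialZeros ∧ |ρ.im| ≤ x}.Finite := by
  have hK : IsCompact (Set.Icc (0 : ℝ) 1 ×ℂ Set.Icc (-x) x) := isCompact_Icc.reProdIm isCompact_Icc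
  refine (hK.inter_riemannZetaZeros_finite).subset ?_
  rintro ρ ⟨⟨h0, h1, h2⟩, h3⟩
  exact ⟨⟨⟨h1.le, h2.le⟩, abs_le.mp h3⟩, h0⟩

/-- `W(x) = ∑_{|γ| ≤ x} |Γ(ρ+1)| x^β / |γ|`, over the non-trivial zeros `ρ = β + iγ`,
each counted with its multiplicity. -/
noncomputable def zeroSumW (x : ℝ) : ℝ :=
  ∑ ρ ∈ (finite_nontrivialZeros_abs_im_le x).toFinset,
    (analyticOrderNatAt riemannZeta ρ : ℝ) * (‖Complex.Gamma (ρ + 1)‖ * x ^ ρ.re / |ρ.im|)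

/-- `ω(x) = inf (δ log x + log γ)`, the infimum over the non-trivial zeros `ρ = β + iγ`
with `γ > 0`, where `δ = 1 - β`. -/
noncomputable def zeroOmega (x : ℝ) : ℝ :=
  sInf {y : ℝ | ∃ ρ ∈ nontrivialZeros, 0 < ρ.im ∧
    y = (1 - ρ.re) * Real.log x + Real.log ρ.im}

/-!
By the definition of `ω`, every zero satisfies
`x ^ β / |γ| = x exp (-(δ log x + log |γ|)) ≤ x exp (-ω(x))`; zeros below the real axis are covered
by conjugation. Hence `W(x) ≤ C x exp (-ω(x))`, where `C` bounds the sum of `|Γ(ρ + 1)|` over any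
finite set of non-trivial zeros, with multiplicity. As `ω(x) → ∞`
(`eventually_forall_le_one_sub_re_mul_log`), the factor `exp (ε ω(x))` eventually exceeds `C`.

The finiteness of `C` (`sum_analyticOrderNatAt_mul_norm_Gamma_le`) needs little precision. The
recurrence of `Γ` and `|Γ(s)| ≤ Γ(Re s)` give `|Γ(ρ + 1)| = O((1 + |ρ|)⁻⁴)` in the strip
(`norm_Gamma_add_one_le`), so a count `O(R²)` of the zeros with `|ρ| ≤ R` is enough. That count
(`sum_analyticOrderNatAt_riemannZeta_le`) is Jensen's inequality for the entire function
`ξ(s) = s (s - 1) Λ₀(s) + 1`, whose growth `exp (O(|s|²))` (`norm_riemannXi_le`) follows from the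
Mellin integral for `Λ₀` in the right half-plane and the functional equation.
-/

/-! ### Growth of the completed zeta function -/

section Growth

open MeasureTheory Set Filter Asymptotics HurwitzZeta

/-- `F = f_modif` is the kernel whose Mellin transform at `s / 2` is `2 Λ₀(s)`. It inherits the
exponential decay of `θ(t) - 1` at infinity, so it tolerates an exponential weight. -/
theorem exists_integrableOn_exp_mul_norm_f_modif :
    ∃ b : ℝ, 0 < b ∧
      IntegrableOn (fun t : ℝ ↦ Real.exp (b * t) * ‖(hurwitzEvenFEPair 0).f_modif t‖) (Ioi 0) := by
  set F := (hurwitzEvenFEPair 0).f_modif with hF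
  obtain ⟨p, hp, hO⟩ := isBigO_atTop_evenKernel_sub 0
  have hI : IntegrableOn F (Ioi 0) := by
    have := ((hurwitzEvenFEPair 0).isStrongFEPair_toStrongFEPair.hasMellin 1).1
    simpa [MellinConvergent, WeakFEPair.toStrongFEPair] using this
  obtain ⟨C, hC⟩ := hO.bound
  obtain ⟨T, hT⟩ := eventually_atTop.1 hC
  -- Half of the decay rate pays for the weight; the other half remains for integrability.
  refine ⟨p / 2, by positivity, ?_⟩
  have hexp : IntegrableOn (fun t : ℝ ↦ Real.exp (-(p / 2) * t)) (Ioi 0) :=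
    integrableOn_exp_mul_Ioi (by linarith) 0
  have hG : IntegrableOn (fun t : ℝ ↦ Real.exp (p / 2 * max T 1) * ‖F t‖
      + |C| * Real.exp (-(p / 2) * t)) (Ioi 0) :=
    (hI.norm.const_mul _).add (hexp.const_mul _)
  refine Integrable.mono' hG ?_ ?_
  · exact ((by fun_prop : Continuous fun t : ℝ ↦ Real.exp (p / 2 * t)).aestronglyMeasurable).mul
      hI.aestronglyMeasurable.norm
  · refine (ae_restrict_iff' measurableSet_Ioi).2 (Eventually.of_forall fun t ht ↦ ?_)
    rw [norm_mul, norm_norm, Real.norm_of_nonneg (Real.exp_pos _).le]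
    rcases le_or_gt t (max T 1) with h | h
    · have h1 : Real.exp (p / 2 * t) * ‖F t‖ ≤ Real.exp (p / 2 * max T 1) * ‖F t‖ := by gcongr
      have h2 : 0 ≤ |C| * Real.exp (-(p / 2) * t) := by positivity
      linarith
    · have h1 : 1 < t := (le_max_right _ _).trans_lt h
      have hFt : ‖F t‖ ≤ |C| * Real.exp (-p * t) := by
        have h3 := hT t ((le_max_left _ _).trans h.le)
        have h4 : F t = ((evenKernel 0 t - 1 : ℝ) : ℂ) := by
          simp [hF, WeakFEPair.f_modif, hurwitzEvenFEPair, h1, not_lt.2 h1.le]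
        rw [h4, Complex.norm_real]
        simp only [if_true, Real.norm_eq_abs, Real.abs_exp] at h3 ⊢
        exact h3.trans (by gcongr; exact le_abs_self C)
      have h5 : Real.exp (p / 2 * t) * (|C| * Real.exp (-p * t))
          = |C| * Real.exp (-(p / 2) * t) := by
        rw [mul_left_comm, ← Real.exp_add]; ring_nf
      have h6 : Real.exp (p / 2 * t) * ‖F t‖ ≤ |C| * Real.exp (-(p / 2) * t) := by
        rw [← h5]; gcongr
      have h7 : 0 ≤ Real.exp (p / 2 * max T 1) * ‖F t‖ := by positivity
      linarith

/-- In the half-plane `0 ≤ Re s` the function `Λ₀` grows at most factorially in `Re s`: the Mellin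
integral is dominated by its value at `Re s`, and `t ^ N ≤ N! b⁻ᴺ exp (b t)` trades a power of `t`
for the exponential decay of the kernel. -/
theorem norm_completedRiemannZeta₀_le_of_re_nonneg :
    ∃ K : ℝ, 1 ≤ K ∧ ∀ (N : ℕ) (s : ℂ), 1 ≤ N → 0 ≤ s.re → s.re ≤ N →
      ‖completedRiemannZeta₀ s‖ ≤ (K * N) ^ N := by
  obtain ⟨b, hb, hI⟩ := exists_integrableOn_exp_mul_norm_f_modif
  set F := (hurwitzEvenFEPair 0).f_modif with hF
  have hI0 : IntegrableOn (fun t : ℝ ↦ t⁻¹ * ‖F t‖) (Ioi 0) := by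
    have := ((hurwitzEvenFEPair 0).isStrongFEPair_toStrongFEPair.hasMellin 0).1
    rw [MellinConvergent] at this
    refine IntegrableOn.congr_fun this.norm (fun t ht ↦ ?_) measurableSet_Ioi
    simp only [norm_smul, WeakFEPair.toStrongFEPair, Complex.norm_cpow_eq_rpow_re_of_pos ht]
    simp [Real.rpow_neg_one, hF]
  set A := ∫ t in Ioi (0 : ℝ), t⁻¹ * ‖F t‖ with hA
  set B := ∫ t in Ioi (0 : ℝ), Real.exp (b * t) * ‖F t‖ with hB
  have hA0 : 0 ≤ A := setIntegral_nonneg measurableSet_Ioi fun t (ht : 0 < t) ↦ by positivity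
  have hB0 : 0 ≤ B := setIntegral_nonneg measurableSet_Ioi fun t (ht : 0 < t) ↦ by positivity
  set D := max b⁻¹ 1 with hD
  have hD1 : 1 ≤ D := le_max_right _ _
  refine ⟨(A + B + 1) * D, one_le_mul_of_one_le_of_one_le (by linarith) hD1,
    fun N s hN hs0 hsN ↦ ?_⟩
  have hN1 : (1 : ℝ) ≤ N := by exact_mod_cast hN
  set c : ℝ := N.factorial * (b⁻¹) ^ N with hc
  have hpt : ∀ t ∈ Ioi (0 : ℝ), ‖(t : ℂ) ^ (s / 2 - 1) • F t‖
      ≤ t⁻¹ * ‖F t‖ + c * (Real.exp (b * t) * ‖F t‖) := by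
    intro t (ht : 0 < t)
    rw [norm_smul, Complex.norm_cpow_eq_rpow_re_of_pos ht, ← mul_assoc, ← add_mul]
    gcongr
    have hre : (s / 2 - 1).re = s.re / 2 - 1 := by simp
    rw [hre]
    rcases le_or_gt t 1 with h | h
    · have h1 : t ^ (s.re / 2 - 1) ≤ t ^ (-1 : ℝ) :=
        Real.rpow_le_rpow_of_exponent_ge ht h (by linarith)
      rw [Real.rpow_neg_one] at h1
      have : 0 ≤ c * Real.exp (b * t) := by positivity
      linarith
    · have h1 : t ^ (s.re / 2 - 1) ≤ t ^ N := by
        rw [← Real.rpow_natCast]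
        exact Real.rpow_le_rpow_of_exponent_le h.le (by linarith)
      have h2 := Real.pow_div_factorial_le_exp (b * t) (by positivity) N
      rw [div_le_iff₀ (by positivity), mul_pow] at h2
      have h3 : t ^ N ≤ c * Real.exp (b * t) := by
        rw [hc, inv_pow]
        field_simp
        linarith
      have : 0 < t⁻¹ := by positivity
      linarith
  have hint : ‖mellin F (s / 2)‖ ≤ A + c * B := by
    rw [mellin, hA, hB, ← integral_const_mul, ← integral_add hI0 (hI.const_mul c)]
    exact norm_integral_le_of_norm_le (hI0.add (hI.const_mul c))
      ((ae_restrict_iff' measurableSet_Ioi).2 (Eventually.of_forall hpt))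
  have hle : ‖completedRiemannZeta₀ s‖ ≤ A + c * B := by
    have : completedRiemannZeta₀ s = mellin F (s / 2) / 2 := rfl
    rw [this, norm_div, Complex.norm_ofNat]
    linarith [norm_nonneg (mellin F (s / 2))]
  have hfac : (N.factorial : ℝ) ≤ (N : ℝ) ^ N := by exact_mod_cast N.factorial_le_pow
  have hDN : 1 ≤ (D * N) ^ N := one_le_pow₀ (one_le_mul_of_one_le_of_one_le hD1 hN1)
  have hcD : c ≤ (D * N) ^ N := by
    rw [hc, mul_pow, mul_comm]
    gcongr
    exact le_max_left _ _
  calc ‖completedRiemannZeta₀ s‖ ≤ A + c * B := hle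
    _ ≤ A * (D * N) ^ N + (D * N) ^ N * B := by
        gcongr
        exact le_mul_of_one_le_right hA0 hDN
    _ ≤ (A + B + 1) * (D * N) ^ N := by nlinarith
    _ ≤ (A + B + 1) ^ N * (D * N) ^ N := by
        gcongr
        exact le_self_pow₀ (by linarith) (by omega)
    _ = ((A + B + 1) * D * N) ^ N := by rw [← mul_pow, mul_assoc]

/-- The Riemann `ξ`-function `s (s - 1) Λ(s)`, up to the factor `1 / 2`, written through the entire
function `Λ₀`, so that it is visibly entire and has the value `1` at `s = 0`. -/
noncomputable def riemannXi (s : ℂ) : ℂ := s * (s - 1) * completedRiemannZeta₀ s + 1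

theorem differentiable_riemannXi : Differentiable ℂ riemannXi := by
  have := differentiable_completedZeta₀
  unfold riemannXi
  fun_prop

theorem riemannXi_eq {s : ℂ} (h0 : s ≠ 0) (h1 : s ≠ 1) :
    riemannXi s = s * (s - 1) * completedRiemannZeta s := by
  have h2 : 1 - s ≠ 0 := sub_ne_zero.2 h1.symm
  rw [riemannXi, completedRiemannZeta_eq]
  field_simp
  ring

/-- `ξ` has growth `exp (O(|s|²))`. The functional equation reduces the left half-plane, where the
Mellin integral is not controlled directly, to the right one. -/
theorem norm_riemannXi_le :
    ∃ C : ℝ, 0 ≤ C ∧ ∀ (n : ℕ) (s : ℂ), 1 ≤ n → ‖s‖ ≤ n →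
      ‖riemannXi s‖ ≤ Real.exp (C * n ^ 2) := by
  obtain ⟨K, hK, h⟩ := norm_completedRiemannZeta₀_le_of_re_nonneg
  refine ⟨4 * K + 14, by linarith, fun n s hn hs ↦ ?_⟩
  have hn1 : (1 : ℝ) ≤ n := by exact_mod_cast hn
  set N : ℕ := n + 1 with hN
  have hNn : (N : ℝ) = n + 1 := by push_cast [hN]; ring
  have hN2 : (N : ℝ) ≤ 2 * n := by linarith
  have hre := (Complex.abs_re_le_norm s).trans hs
  have hΛ : ‖completedRiemannZeta₀ s‖ ≤ (K * N) ^ N := by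
    rcases le_or_gt 0 s.re with h0 | h0
    · exact h N s (by omega) h0 (by linarith [le_abs_self s.re])
    · rw [← completedRiemannZeta₀_one_sub]
      refine h N (1 - s) (by omega) ?_ ?_
      · simp; linarith
      · simp; linarith [neg_abs_le s.re]
  have hs1 : ‖s - 1‖ ≤ N := (norm_sub_le _ _).trans (by simp; linarith)
  have hNe : (N : ℝ) ≤ Real.exp N := by linarith [Real.add_one_le_exp (N : ℝ)]
  have hKe : K ≤ Real.exp K := by linarith [Real.add_one_le_exp K]
  have hKN : 1 ≤ (K * N) ^ N :=
    one_le_pow₀ (one_le_mul_of_one_le_of_one_le hK (by linarith))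
  have hX : ‖riemannXi s‖ ≤ N * N * (K * N) ^ N + 1 := by
    refine (norm_add_le _ _).trans ?_
    rw [norm_mul, norm_mul, norm_one]
    gcongr
    linarith
  have hNN : 1 ≤ (N : ℝ) * N := one_le_mul_of_one_le_of_one_le (by linarith) (by linarith)
  have h2e : (2 : ℝ) ≤ Real.exp 1 := by linarith [Real.add_one_le_exp (1 : ℝ)]
  calc ‖riemannXi s‖ ≤ N * N * (K * N) ^ N + 1 := hX
    _ ≤ 2 * (N * N * (K * N) ^ N) := by
        linarith [one_le_mul_of_one_le_of_one_le hNN hKN]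
    _ ≤ Real.exp 1 * (Real.exp N * Real.exp N * (Real.exp K * Real.exp N) ^ N) := by
        gcongr
    _ = Real.exp (1 + (N + N + N * (K + N))) := by
        rw [← Real.exp_add K, ← Real.exp_nat_mul, ← Real.exp_add, ← Real.exp_add, ← Real.exp_add]
    _ ≤ Real.exp ((4 * K + 14) * n ^ 2) := by
        apply Real.exp_le_exp.2
        rw [hNn]
        nlinarith [mul_nonneg (by linarith : (0:ℝ) ≤ K) (by nlinarith : (0:ℝ) ≤ (n:ℝ) ^ 2 - n)]

end Growth

/-! ### Counting zeros with multiplicity -/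

/-- In the critical strip `ξ` and `ζ` differ by the factor `s (s - 1) Γ_ℝ(s)`, which is analytic and
has no zero there. -/
theorem analyticOrderNatAt_riemannZeta_eq {ρ : ℂ} (hρ : ρ ∈ nontrivialZeros) :
    analyticOrderNatAt riemannZeta ρ = analyticOrderNatAt riemannXi ρ := by
  obtain ⟨-, h0, h1⟩ := hρ
  have hρ0 : ρ ≠ 0 := by rintro rfl; simp at h0
  have hρ1 : ρ ≠ 1 := by rintro rfl; simp at h1
  have hζ : AnalyticAt ℂ riemannZeta ρ := analyticOn_riemannZeta ρ hρ1
  -- The double inverse gives access to the analyticity of the entire function `1 / Γ_ℝ`.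
  have hG : AnalyticAt ℂ (fun s : ℂ ↦ s * (s - 1) * ((Complex.Gammaℝ s)⁻¹)⁻¹) ρ := by
    have hne : (Complex.Gammaℝ ρ)⁻¹ ≠ 0 := inv_ne_zero (Complex.Gammaℝ_ne_zero_of_re_pos h0)
    have h2 : AnalyticAt ℂ (fun s : ℂ ↦ (Complex.Gammaℝ s)⁻¹) ρ :=
      Complex.differentiable_Gammaℝ_inv.analyticAt ρ
    exact ((analyticAt_id).mul (analyticAt_id.sub analyticAt_const)).mul (h2.inv hne)
  have hG0 : analyticOrderAt (fun s : ℂ ↦ s * (s - 1) * ((Complex.Gammaℝ s)⁻¹)⁻¹) ρ = 0 := by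
    rw [hG.analyticOrderAt_eq_zero, inv_inv]
    exact mul_ne_zero (mul_ne_zero hρ0 (sub_ne_zero.2 hρ1)) (Complex.Gammaℝ_ne_zero_of_re_pos h0)
  have hev : riemannXi =ᶠ[nhds ρ]
      (fun s : ℂ ↦ s * (s - 1) * ((Complex.Gammaℝ s)⁻¹)⁻¹) * riemannZeta := by
    have hpos : ∀ᶠ s : ℂ in nhds ρ, 0 < s.re :=
      (isOpen_lt continuous_const Complex.continuous_re).mem_nhds h0
    filter_upwards [hpos, eventually_ne_nhds hρ1] with s hs hs1
    have hs0 : s ≠ 0 := by rintro rfl; simp at hs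
    have := Complex.Gammaℝ_ne_zero_of_re_pos hs
    rw [riemannXi_eq hs0 hs1, Pi.mul_apply, riemannZeta_def_of_ne_zero hs0, inv_inv]
    field_simp
  rw [analyticOrderNatAt, analyticOrderNatAt, analyticOrderAt_congr hev,
    analyticOrderAt_mul hG hζ, hG0, zero_add]

/-- Jensen's inequality for `ξ` on discs centred at `0`, where `ξ(0) = 1`: the number of zeros of
modulus at most `n` is `O(n²)`. -/
theorem sum_analyticOrderNatAt_riemannZeta_le :
    ∃ C : ℝ, 0 ≤ C ∧ ∀ (n : ℕ) (s : Finset ℂ), 1 ≤ n →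
      (∀ ρ ∈ s, ρ ∈ nontrivialZeros ∧ ‖ρ‖ ≤ n) →
      ∑ ρ ∈ s, (analyticOrderNatAt riemannZeta ρ : ℝ) ≤ C * n ^ 2 := by
  obtain ⟨C, hC, h⟩ := norm_riemannXi_le
  have hlog : 0 < Real.log 2 := Real.log_pos one_lt_two
  refine ⟨C * 4 / Real.log 2, by positivity, fun n s hn hs ↦ ?_⟩
  have hn0 : (0 : ℝ) < n := by exact_mod_cast hn
  have han : ∀ U, AnalyticOnNhd ℂ riemannXi U := fun U z _ ↦
    differentiable_riemannXi.analyticAt z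
  have h0 : riemannXi 0 = 1 := by simp [riemannXi]
  have habs : |(n : ℝ)| = n := abs_of_pos hn0
  have habs2 : |2 * (n : ℝ)| = 2 * n := abs_of_pos (by positivity)
  have hJ := AnalyticOnNhd.sum_divisor_le (c := 0) (r := n) (R := 2 * n)
    (M := Real.exp (C * (2 * n) ^ 2)) (f := riemannXi) (by rwa [habs])
    (by rw [habs, habs2]; linarith) (Real.one_le_exp (by positivity)) (han _)
    (by rw [h0]; exact one_ne_zero) (fun z hz ↦ by
      have hz' : ‖z‖ ≤ (2 * n : ℕ) := by
        rw [habs2, mem_sphere_zero_iff_norm] at hz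
        rw [hz]; push_cast; rfl
      simpa using h (2 * n) z (by omega) hz')
  rw [h0, norm_one, div_one, Real.log_exp, habs, mul_div_cancel_right₀ _ hn0.ne'] at hJ
  have hfin := (MeromorphicOn.divisor riemannXi (Metric.closedBall 0 (n : ℝ))).finiteSupport
    (isCompact_closedBall _ _)
  have hnn : ∀ u, 0 ≤ MeromorphicOn.divisor riemannXi (Metric.closedBall 0 (n : ℝ)) u :=
    fun u ↦ MeromorphicOn.AnalyticOnNhd.divisor_nonneg (han _) u
  have hterm : ∀ ρ ∈ s, ((analyticOrderNatAt riemannZeta ρ : ℕ) : ℤ)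
      = MeromorphicOn.divisor riemannXi (Metric.closedBall 0 (n : ℝ)) ρ := by
    intro ρ hρ
    obtain ⟨hz, hle⟩ := hs ρ hρ
    have htop : analyticOrderAt riemannXi ρ ≠ ⊤ := by
      refine (han Set.univ).analyticOrderAt_ne_top_of_isPreconnected isPreconnected_univ
        (Set.mem_univ 0) (Set.mem_univ ρ) ?_
      rw [((han Set.univ) 0 trivial).analyticOrderAt_eq_zero.2 (by simp [h0])]
      exact ENat.zero_ne_top
    rw [MeromorphicOn.AnalyticOnNhd.divisor_apply (han _) (by simpa using hle),
      analyticOrderNatAt_riemannZeta_eq hz, analyticOrderNatAt]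
    lift analyticOrderAt riemannXi ρ to ℕ using htop with k
    simp
  have hsum : ∑ ρ ∈ s, ((analyticOrderNatAt riemannZeta ρ : ℕ) : ℤ)
      ≤ ∑ᶠ u, MeromorphicOn.divisor riemannXi (Metric.closedBall 0 (n : ℝ)) u := by
    rw [Finset.sum_congr rfl hterm, finsum_eq_sum _ hfin]
    have hsupp : hfin.toFinset ⊆ s ∪ hfin.toFinset := Finset.subset_union_right
    rw [Finset.sum_subset hsupp fun u _ hu ↦ by simpa using hu]
    exact Finset.sum_le_sum_of_subset_of_nonneg Finset.subset_union_left fun u _ _ ↦ hnn u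
  calc ∑ ρ ∈ s, (analyticOrderNatAt riemannZeta ρ : ℝ)
      = ((∑ ρ ∈ s, ((analyticOrderNatAt riemannZeta ρ : ℕ) : ℤ) : ℤ) : ℝ) := by push_cast; rfl
    _ ≤ _ := by exact_mod_cast hsum
    _ ≤ C * (2 * n) ^ 2 / Real.log 2 := hJ
    _ = C * 4 / Real.log 2 * n ^ 2 := by ring

/-! ### Decay of the Gamma factor -/

theorem Complex.norm_Gamma_le_Gamma_re {s : ℂ} (hs : 0 < s.re) :
    ‖Complex.Gamma s‖ ≤ Real.Gamma s.re := by
  rw [Complex.Gamma_eq_integral hs, Real.Gamma_eq_integral hs, Complex.GammaIntegral]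
  refine MeasureTheory.norm_integral_le_of_norm_le (Real.GammaIntegral_convergent hs) ?_
  refine (MeasureTheory.ae_restrict_iff' measurableSet_Ioi).2
    (Filter.Eventually.of_forall fun t (ht : 0 < t) ↦ ?_)
  rw [norm_mul, Complex.norm_cpow_eq_rpow_re_of_pos ht, Complex.norm_real, Real.norm_eq_abs,
    Real.abs_exp]
  simp

/-- In the critical strip the recurrence `Γ(ρ + 5) = (ρ + 4)(ρ + 3)(ρ + 2)(ρ + 1) Γ(ρ + 1)` gives
four powers of decay; this is weaker than Stirling's formula but beats the number of zeros. -/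
theorem norm_Gamma_add_one_le {ρ : ℂ} (h0 : 0 < ρ.re) (h1 : ρ.re < 1) {k : ℕ} (hk : k ≤ ‖ρ‖) :
    ‖Complex.Gamma (ρ + 1)‖ ≤ 1920 / (k + 1 : ℝ) ^ 4 := by
  have hre : ∀ j : ℕ, 0 < (ρ + j).re := fun j ↦ by simp; positivity
  have hne : ∀ j : ℕ, ρ + j ≠ 0 := fun j h ↦ by have := hre j; rw [h] at this; simp at this
  have hrec : Complex.Gamma (ρ + 5) = (ρ + 4) * (ρ + 3) * (ρ + 2) * (ρ + 1)
      * Complex.Gamma (ρ + 1) := by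
    have e1 := Complex.Gamma_add_one _ (hne 1)
    have e2 := Complex.Gamma_add_one _ (hne 2)
    have e3 := Complex.Gamma_add_one _ (hne 3)
    have e4 := Complex.Gamma_add_one _ (hne 4)
    push_cast at e1 e2 e3 e4
    rw [show ρ + 1 + 1 = ρ + 2 by ring] at e1
    rw [show ρ + 2 + 1 = ρ + 3 by ring] at e2
    rw [show ρ + 3 + 1 = ρ + 4 by ring] at e3
    rw [show ρ + 4 + 1 = ρ + 5 by ring] at e4
    rw [e4, e3, e2, e1]; ring
  have h120 : ‖Complex.Gamma (ρ + 5)‖ ≤ 120 := by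
    have hle := Complex.norm_Gamma_le_Gamma_re (s := ρ + 5) (by simp; positivity)
    have hmono : Real.Gamma (ρ + 5).re ≤ Real.Gamma 6 :=
      Real.Gamma_strictMonoOn_Ici.monotoneOn (by simp; linarith) (by norm_num) (by simp; linarith)
    have h6 : Real.Gamma 6 = 120 := by
      rw [show (6 : ℝ) = (5 : ℕ) + 1 by norm_num, Real.Gamma_nat_eq_factorial]
      norm_num [Nat.factorial]
    linarith
  have hlow : ∀ j : ℕ, 1 ≤ j → (k + 1 : ℝ) / 2 ≤ ‖ρ + j‖ := by
    intro j hj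
    have hj' : (1 : ℝ) ≤ j := by exact_mod_cast hj
    have ha : ‖ρ‖ ≤ ‖ρ + j‖ := by
      rw [Complex.norm_def, Complex.norm_def]
      refine Real.sqrt_le_sqrt ?_
      simp only [Complex.normSq_apply, Complex.add_re, Complex.natCast_re, Complex.add_im,
        Complex.natCast_im, add_zero]
      nlinarith
    have hb : 1 ≤ ‖ρ + j‖ := by
      refine le_trans ?_ (Complex.re_le_norm _)
      simp; linarith
    linarith
  have l1 := hlow 1 (by norm_num)
  have l2 := hlow 2 (by norm_num)
  have l3 := hlow 3 (by norm_num)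
  have l4 := hlow 4 (by norm_num)
  push_cast at l1 l2 l3 l4
  rw [le_div_iff₀ (by positivity)]
  have hprod : ((k + 1 : ℝ) / 2) * ((k + 1) / 2) * ((k + 1) / 2) * ((k + 1) / 2)
      * ‖Complex.Gamma (ρ + 1)‖ ≤ 120 := by
    refine le_trans ?_ h120
    rw [hrec]
    simp only [norm_mul]
    gcongr
  linarith

/-- The Gamma factors of all zeros have a finite sum: zeros with `⌊‖ρ‖⌋ = k` number `O((k + 1)²)`
and carry weights `O((k + 1)⁻⁴)`. -/
theorem sum_analyticOrderNatAt_mul_norm_Gamma_le :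
    ∃ C : ℝ, 1 ≤ C ∧ ∀ s : Finset ℂ, (∀ ρ ∈ s, ρ ∈ nontrivialZeros) →
      ∑ ρ ∈ s, (analyticOrderNatAt riemannZeta ρ : ℝ) * ‖Complex.Gamma (ρ + 1)‖ ≤ C := by
  obtain ⟨C, hC, hcount⟩ := sum_analyticOrderNatAt_riemannZeta_le
  have hsumm : Summable fun k : ℕ ↦ 1 / ((k + 1 : ℝ)) ^ 2 := by
    exact_mod_cast (summable_nat_add_iff 1).2 (Real.summable_one_div_nat_pow.2 one_lt_two)
  set Z := ∑' k : ℕ, 1 / ((k + 1 : ℝ)) ^ 2 with hZ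
  have hZ0 : 0 ≤ Z := tsum_nonneg fun k ↦ by positivity
  refine ⟨C * 1920 * Z + 1, le_add_of_nonneg_left (by positivity), fun s hs ↦ ?_⟩
  classical
  set t := s.image fun ρ : ℂ ↦ ⌊‖ρ‖⌋₊ with ht
  rw [← Finset.sum_fiberwise_of_maps_to (t := t)
    (fun ρ hρ ↦ Finset.mem_image_of_mem (fun ρ : ℂ ↦ ⌊‖ρ‖⌋₊) hρ)]
  have hfib : ∀ k ∈ t, ∑ ρ ∈ s with ⌊‖ρ‖⌋₊ = k,
      (analyticOrderNatAt riemannZeta ρ : ℝ) * ‖Complex.Gamma (ρ + 1)‖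
      ≤ C * 1920 * (1 / ((k + 1 : ℝ)) ^ 2) := by
    intro k _
    have h1 := hcount (k + 1) (s.filter fun ρ ↦ ⌊‖ρ‖⌋₊ = k) (by omega) (fun ρ hρ ↦ by
      obtain ⟨hρs, rfl⟩ := Finset.mem_filter.1 hρ
      exact ⟨hs ρ hρs, by push_cast; exact (Nat.lt_floor_add_one _).le⟩)
    push_cast at h1
    calc _ ≤ ∑ ρ ∈ s with ⌊‖ρ‖⌋₊ = k,
          (analyticOrderNatAt riemannZeta ρ : ℝ) * (1920 / (k + 1 : ℝ) ^ 4) := by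
          refine Finset.sum_le_sum fun ρ hρ ↦ ?_
          obtain ⟨hρs, rfl⟩ := Finset.mem_filter.1 hρ
          gcongr
          exact norm_Gamma_add_one_le (hs ρ hρs).2.1 (hs ρ hρs).2.2
            (Nat.floor_le (norm_nonneg _))
      _ ≤ C * (k + 1 : ℝ) ^ 2 * (1920 / (k + 1 : ℝ) ^ 4) := by
          rw [← Finset.sum_mul]; gcongr
      _ = C * 1920 * (1 / ((k + 1 : ℝ)) ^ 2) := by field_simp
  calc _ ≤ ∑ k ∈ t, C * 1920 * (1 / ((k + 1 : ℝ)) ^ 2) := Finset.sum_le_sum hfib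
    _ ≤ C * 1920 * Z := by
        rw [← Finset.mul_sum]
        gcongr
        exact hsumm.sum_le_tsum _ fun k _ ↦ by positivity
    _ ≤ _ := by linarith

/-! ### Divergence of `ω` and the final estimate -/

/-- The function `ω` tends to infinity, stated zero by zero: only finitely many zeros lie
below height `exp T`, and each of them has `1 - ρ.re > 0`. -/
theorem eventually_forall_le_one_sub_re_mul_log (T : ℝ) :
    ∀ᶠ x : ℝ in Filter.atTop, ∀ ρ ∈ nontrivialZeros, 0 < ρ.im →
      T ≤ (1 - ρ.re) * Real.log x + Real.log ρ.im := by
  have hlow : ∀ᶠ x : ℝ in Filter.atTop,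
      ∀ ρ ∈ {ρ : ℂ | ρ ∈ nontrivialZeros ∧ |ρ.im| ≤ Real.exp T},
      T ≤ (1 - ρ.re) * Real.log x + Real.log ρ.im := by
    refine (Filter.eventually_all_finite (finite_nontrivialZeros_abs_im_le _)).2 fun ρ hρ ↦ ?_
    have hδ : 0 < 1 - ρ.re := sub_pos.2 hρ.1.2.2
    exact (Filter.tendsto_atTop_add_const_right _ _
      (Real.tendsto_log_atTop.const_mul_atTop hδ)).eventually_ge_atTop T
  filter_upwards [hlow, Filter.eventually_ge_atTop 1] with x hx hx1 ρ hρ him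
  rcases le_or_gt |ρ.im| (Real.exp T) with h | h
  · exact hx ρ ⟨hρ, h⟩
  · rw [abs_of_pos him] at h
    have h1 : T < Real.log ρ.im := (Real.lt_log_iff_exp_lt him).2 h
    have h2 : 0 ≤ (1 - ρ.re) * Real.log x :=
      mul_nonneg (sub_nonneg.2 hρ.2.2.le) (Real.log_nonneg hx1)
    linarith

theorem conj_mem_nontrivialZeros {ρ : ℂ} (hρ : ρ ∈ nontrivialZeros) :
    (starRingEnd ℂ) ρ ∈ nontrivialZeros := by
  obtain ⟨h, h0, h1⟩ := hρ
  exact ⟨by rw [riemannZeta_conj, h, map_zero], by simpa using h0, by simpa using h1⟩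

theorem exists_mem_nontrivialZeros_im_eq_abs {ρ : ℂ} (hρ : ρ ∈ nontrivialZeros) :
    ∃ ρ' ∈ nontrivialZeros, ρ'.re = ρ.re ∧ ρ'.im = |ρ.im| := by
  rcases le_total 0 ρ.im with h | h
  · exact ⟨ρ, hρ, rfl, (abs_of_nonneg h).symm⟩
  · exact ⟨_, conj_mem_nontrivialZeros hρ, Complex.conj_re _, by simp [abs_of_nonpos h]⟩

theorem lemma1 (ε : ℝ) (hε : 0 < ε) :
    ∀ᶠ x : ℝ in Filter.atTop,
      zeroSumW x ≤ x * Real.exp (-((1 - ε) * zeroOmega x)) := by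
  obtain ⟨C, hC, hsum⟩ := sum_analyticOrderNatAt_mul_norm_Gamma_le
  -- The threshold `log C / ε` for `ω` is the one at which `exp (ε ω)` absorbs the constant `C`.
  have hC0 : 0 < C := one_pos.trans_le hC
  filter_upwards [eventually_forall_le_one_sub_re_mul_log (Real.log C / ε),
    Filter.eventually_gt_atTop 0] with x hx hx0
  by_cases hne : ∃ ρ ∈ nontrivialZeros, 0 < ρ.im
  · obtain ⟨ρ₀, hρ₀, him₀⟩ := hne
    have hω : Real.log C / ε ≤ zeroOmega x := by
      refine le_csInf ⟨_, ρ₀, hρ₀, him₀, rfl⟩ ?_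
      rintro _ ⟨ρ, hρ, him, rfl⟩
      exact hx ρ hρ him
    have hωle : ∀ ρ ∈ nontrivialZeros, 0 < ρ.im →
        zeroOmega x ≤ (1 - ρ.re) * Real.log x + Real.log ρ.im := by
      intro ρ hρ him
      refine csInf_le ⟨Real.log C / ε, ?_⟩ ⟨ρ, hρ, him, rfl⟩
      rintro _ ⟨ρ', hρ', him', rfl⟩
      exact hx ρ' hρ' him'
    have hterm : ∀ ρ ∈ nontrivialZeros,
        x ^ ρ.re / |ρ.im| ≤ x * Real.exp (-zeroOmega x) := by
      intro ρ hρ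
      rcases eq_or_ne ρ.im 0 with h0 | h0
      · -- There is nothing to bound for a zero on the real axis: the quotient is then `0`.
        rw [h0, abs_zero, div_zero]
        positivity
      · obtain ⟨ρ', hρ', hre, him⟩ := exists_mem_nontrivialZeros_im_eq_abs hρ
        have hpos : 0 < |ρ.im| := abs_pos.2 h0
        have hle := hωle ρ' hρ' (him ▸ hpos)
        rw [hre, him] at hle
        calc x ^ ρ.re / |ρ.im|
            = Real.exp (Real.log x + -((1 - ρ.re) * Real.log x + Real.log |ρ.im|)) := by
              rw [show Real.log x + -((1 - ρ.re) * Real.log x + Real.log |ρ.im|)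
                = Real.log x * ρ.re - Real.log |ρ.im| by ring, Real.exp_sub, Real.exp_log hpos,
                Real.rpow_def_of_pos hx0]
          _ ≤ Real.exp (Real.log x + -zeroOmega x) := by gcongr
          _ = x * Real.exp (-zeroOmega x) := by rw [Real.exp_add, Real.exp_log hx0]
    have hCω : C ≤ Real.exp (ε * zeroOmega x) := by
      rw [← Real.log_le_iff_le_exp hC0]
      rwa [div_le_iff₀' hε] at hω
    calc zeroSumW x
        ≤ ∑ ρ ∈ (finite_nontrivialZeros_abs_im_le x).toFinset,
            (analyticOrderNatAt riemannZeta ρ : ℝ) * ‖Complex.Gamma (ρ + 1)‖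
              * (x * Real.exp (-zeroOmega x)) := by
          refine Finset.sum_le_sum fun ρ hρ ↦ ?_
          rw [mul_div_assoc, ← mul_assoc]
          gcongr
          exact hterm ρ ((Set.Finite.mem_toFinset _).1 hρ).1
      _ ≤ C * (x * Real.exp (-zeroOmega x)) := by
          rw [← Finset.sum_mul]
          gcongr
          exact hsum _ fun ρ hρ ↦ ((Set.Finite.mem_toFinset _).1 hρ).1
      _ ≤ Real.exp (ε * zeroOmega x) * (x * Real.exp (-zeroOmega x)) := by gcongr
      _ = x * Real.exp (-((1 - ε) * zeroOmega x)) := by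
          rw [mul_left_comm, ← Real.exp_add]
          ring_nf
  · -- Without a zero in the upper half-plane the sum has, by symmetry, no non-zero term.
    have hW : zeroSumW x = 0 := by
      refine Finset.sum_eq_zero fun ρ hρ ↦ ?_
      obtain ⟨ρ', hρ', -, him⟩ :=
        exists_mem_nontrivialZeros_im_eq_abs ((Set.Finite.mem_toFinset _).1 hρ).1
      have h0 : |ρ.im| = 0 :=
        le_antisymm (not_lt.1 fun h ↦ hne ⟨ρ', hρ', him ▸ h⟩) (abs_nonneg _)
      rw [h0, div_zero, mul_zero]
    rw [hW]
    positivity
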